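/- Let $d,k$ be integers with $1\le k\le d-1$ and let $Q=[0,1]^d$. Then there exists a bounded measurable differential $(k+1)$-form $\eta\in L^\infty(\mathbb{R}^d,\bigwedge^{k+1}(\mathbb{R}^d)^*)$, vanishing outside $Q$, which is distributionally closed on $\mathbb{R}^d$, i.e. $$\int_{\mathbb{R}^d} \mathrm{d}\varphi\wedge\eta\;\mathrm{d}x=0\in\textstyle\bigwedge^{k+2}(\mathbb{R}^d)^*\qquad\text{for every }\varphi\in C_c^\infty(\mathbb{R}^d),$$ where the covector-valued integral is taken coefficientwise, such that there is no Lipschitz differential $k$-form $\omega\colon Q\to\bigwedge^k(\mathbb{R}^d)^*$ satisfying $$\mathrm{d}\omega=\eta\quad\text{almost everywhere in }Q.$$ -/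

import Mathlib

open MeasureTheory
open scoped ENNReal

/-- The closed unit cube `[0,1]^d` in Euclidean space. -/
def unitCube (d : ℕ) : Set (EuclideanSpace ℝ (Fin d)) :=
  {x | ∀ i, x i ∈ Set.Icc (0 : ℝ) 1}

/-- Differential `m`-forms on `ℝ^d`, not assumed to have any regularity. The operator norm on
`m`-covectors is the comass norm. -/
abbrev DiffForm (d m : ℕ) : Type :=
  EuclideanSpace ℝ (Fin d) → EuclideanSpace ℝ (Fin d) [⋀^Fin m]→L[ℝ] ℝ

/-- The locally integrable `m`-form `η` on `ℝ^d` is distributionally closed, `dη = 0`: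
the `(m+1)`-covector valued distribution `dη`, given by `φ ↦ - ∫ dφ ∧ η`, vanishes on every
`φ ∈ C_c^∞(ℝ^d)`. The sum below is `(dφ ∧ η)_x (v_0, …, v_m)`. -/
def DistributionallyClosed {d m : ℕ} (η : DiffForm d m) : Prop :=
  LocallyIntegrable η volume ∧
    ∀ φ : EuclideanSpace ℝ (Fin d) → ℝ, ContDiff ℝ (⊤ : ℕ∞) φ → HasCompactSupport φ →
      ∀ v : Fin (m + 1) → EuclideanSpace ℝ (Fin d),
        ∫ x, ∑ i : Fin (m + 1),
          (-1 : ℝ) ^ (i : ℕ) * (fderiv ℝ φ x (v i) * η x (i.removeNth v)) = 0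

/-- `ω` is a Lipschitz `k`-form on the set `Q` and `dω = η` almost everywhere in `Q`. Only the values
of `ω` on `Q` matter; for the cube, `dω` exists almost everywhere in `Q` by Rademacher's theorem. -/
def IsLipschitzSolutionOn {d k : ℕ} (Q : Set (EuclideanSpace ℝ (Fin d)))
    (η : DiffForm d (k + 1)) (ω : DiffForm d k) : Prop :=
  (∃ C : NNReal, LipschitzOnWith C ω Q) ∧
    ∀ᵐ x ∂(volume.restrict Q), extDerivWithin ω Q x = η x

/-! The obstruction is the failure of an L¹ estimate, in the spirit of Ornstein's non-inequality,
transferred to forms by duality. Write `0, …, k` for the directions `t 0, …, t k`. One coefficient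
of `dω` is a divergence `∑ ∂ⱼuⱼ` with Lipschitz `uⱼ`. Integrating it against `∂₀∂₁g` and exchanging
derivatives leaves `∂₁∂₁g` for `j = 1` and `∂₀∂ⱼg` for `j ≠ 1`, so the pairing is controlled by the
L¹ norms of these derivatives alone (`abs_integral_extDerivWithin_mul_le`).

The form `η` is a sum of exact pieces `d(wₙ dx₁ ∧ … ∧ dxₖ)` on disjoint compact sets. Since `dx₁`
occurs in the wedge, `∂₁wₙ` drops out and only the other derivatives of `wₙ` must be bounded. By
`exists_large_pairing` they can be, with the L¹ norms above bounded too, while `∫ ∂₀wₙ ∂₀∂₁gₙ ≥ n`.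

For that lemma, take a Riesz product `P = χ ∏ (1 + cos(Nⱼaⱼ))` with `aⱼ = x₀ + τⱼx₁`, `τⱼ = ±1`, and
frequencies chosen successively. A suitable `g` has `∂₀∂₀g` and `∂₁∂₁g` close to `P - χ`, which is
bounded in L¹ because `P ≥ 0` and `∫P ≈ ∫χ`; in `∂₀∂₁g` each increment carries the sign `τⱼ`. The
function `∂₀w ≈ F` detects these signs, where `G + iF = χ ∏ (1 + icτⱼ cos(Nⱼaⱼ))`. With `2n` factors
and `c = n^(-1/2)` this product stays bounded, but the pairing reaches order `√n`. -/

open Filter Topology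

/-! ### Smooth functions supported in a fixed compact set, and their directional derivatives. -/

section TestFunctions

variable {E : Type*} [NormedAddCommGroup E] [NormedSpace ℝ E]

/-- Smooth functions vanishing outside `K`. -/
structure IsTest (K : Set E) (f : E → ℝ) : Prop where
  contDiff : ContDiff ℝ (⊤ : ℕ∞) f
  eq_zero : ∀ x, x ∉ K → f x = 0

/-- The derivative of `f` in the direction `v`. -/
noncomputable def dirDeriv (v : E) (f : E → ℝ) : E → ℝ := fun x => fderiv ℝ f x v

variable {K : Set E} {f g : E → ℝ}

namespace IsTest

theorem differentiable (hf : IsTest K f) : Differentiable ℝ f :=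
  hf.contDiff.differentiable (by simp)

theorem continuous (hf : IsTest K f) : Continuous f := hf.contDiff.continuous

theorem zero (K : Set E) : IsTest K (fun _ => 0) := ⟨contDiff_const, fun _ _ => rfl⟩

theorem add (hf : IsTest K f) (hg : IsTest K g) : IsTest K (fun x => f x + g x) :=
  ⟨hf.contDiff.add hg.contDiff, fun x hx => by rw [hf.eq_zero x hx, hg.eq_zero x hx, add_zero]⟩

theorem sub (hf : IsTest K f) (hg : IsTest K g) : IsTest K (fun x => f x - g x) :=
  ⟨hf.contDiff.sub hg.contDiff, fun x hx => by rw [hf.eq_zero x hx, hg.eq_zero x hx, sub_zero]⟩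

theorem mul_contDiff (hf : IsTest K f) (hg : ContDiff ℝ (⊤ : ℕ∞) g) :
    IsTest K (fun x => f x * g x) :=
  ⟨hf.contDiff.mul hg, fun x hx => by rw [hf.eq_zero x hx, zero_mul]⟩

theorem mul (hf : IsTest K f) (hg : IsTest K g) : IsTest K (fun x => f x * g x) :=
  hf.mul_contDiff hg.contDiff

theorem const_mul (hf : IsTest K f) (c : ℝ) : IsTest K (fun x => c * f x) :=
  ⟨contDiff_const.mul hf.contDiff, fun x hx => by rw [hf.eq_zero x hx, mul_zero]⟩

theorem along (hf : IsTest K f) (hK : IsClosed K) (v : E) : IsTest K (dirDeriv v f) := by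
  refine ⟨(hf.contDiff.fderiv_right (m := (⊤ : ℕ∞)) (by simp)).clm_apply contDiff_const,
    fun x hx => ?_⟩
  have h : f =ᶠ[𝓝 x] fun _ => 0 := by
    filter_upwards [hK.isOpen_compl.mem_nhds hx] with y hy using hf.eq_zero y hy
  simp [dirDeriv, h.fderiv_eq]

theorem hasCompactSupport (hf : IsTest K f) (hK : IsCompact K) : HasCompactSupport f :=
  HasCompactSupport.intro hK hf.eq_zero

theorem exists_bound (hf : IsTest K f) (hK : IsCompact K) : ∃ C, 0 ≤ C ∧ ∀ x, |f x| ≤ C := by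
  obtain ⟨C, hC⟩ := (hf.hasCompactSupport hK).exists_bound_of_continuous hf.continuous
  exact ⟨C, (norm_nonneg _).trans (hC 0), hC⟩

end IsTest

theorem dirDeriv_add (hf : Differentiable ℝ f) (hg : Differentiable ℝ g) (v x : E) :
    dirDeriv v (fun x => f x + g x) x = dirDeriv v f x + dirDeriv v g x := by
  simp [dirDeriv, fderiv_fun_add (hf x) (hg x)]

theorem dirDeriv_sub (hf : Differentiable ℝ f) (hg : Differentiable ℝ g) (v x : E) :
    dirDeriv v (fun x => f x - g x) x = dirDeriv v f x - dirDeriv v g x := by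
  simp [dirDeriv, fderiv_fun_sub (hf x) (hg x)]

theorem dirDeriv_const_mul (hf : Differentiable ℝ f) (c : ℝ) (v x : E) :
    dirDeriv v (fun x => c * f x) x = c * dirDeriv v f x := by
  simp [dirDeriv, fderiv_const_mul (hf x)]

theorem dirDeriv_mul (hf : Differentiable ℝ f) (hg : Differentiable ℝ g) (v x : E) :
    dirDeriv v (fun x => f x * g x) x = dirDeriv v f x * g x + f x * dirDeriv v g x := by
  simp [dirDeriv, fderiv_fun_mul (hf x) (hg x)]
  ring

theorem dirDeriv_cos (a : E →L[ℝ] ℝ) (N : ℝ) (v x : E) :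
    dirDeriv v (fun x => Real.cos (N * a x)) x = -(N * a v * Real.sin (N * a x)) := by
  have h : HasFDerivAt (fun x => N * a x) (N • a) x := a.hasFDerivAt.const_mul N
  simp [dirDeriv, h.cos.fderiv]
  ring

theorem dirDeriv_sin (a : E →L[ℝ] ℝ) (N : ℝ) (v x : E) :
    dirDeriv v (fun x => Real.sin (N * a x)) x = N * a v * Real.cos (N * a x) := by
  have h : HasFDerivAt (fun x => N * a x) (N • a) x := a.hasFDerivAt.const_mul N
  simp [dirDeriv, h.sin.fderiv]
  ring

theorem contDiff_cos_mul (a : E →L[ℝ] ℝ) (N : ℝ) :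
    ContDiff ℝ (⊤ : ℕ∞) (fun x => Real.cos (N * a x)) :=
  (contDiff_const.mul a.contDiff).cos

theorem contDiff_sin_mul (a : E →L[ℝ] ℝ) (N : ℝ) :
    ContDiff ℝ (⊤ : ℕ∞) (fun x => Real.sin (N * a x)) :=
  (contDiff_const.mul a.contDiff).sin

theorem two_le_infty : (2 : WithTop ℕ∞) ≤ ((⊤ : ℕ∞) : WithTop ℕ∞) := by
  exact WithTop.coe_le_coe.2 (le_top : (2 : ℕ∞) ≤ ⊤)

theorem dirDeriv_comm (hf : ContDiff ℝ (⊤ : ℕ∞) f) (v w : E) :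
    dirDeriv v (dirDeriv w f) = dirDeriv w (dirDeriv v f) := by
  have key : ∀ (a b x : E), dirDeriv a (dirDeriv b f) x = fderiv ℝ (fderiv ℝ f) x a b := by
    intro a b x
    have h : DifferentiableAt ℝ (fderiv ℝ f) x :=
      ((hf.fderiv_right (m := (⊤ : ℕ∞)) (by simp)).differentiable (by simp)) x
    unfold dirDeriv
    rw [fderiv_clm_apply h (differentiableAt_const b)]
    simp
  funext x
  rw [key, key]
  exact (hf.contDiffAt.isSymmSndFDerivAt (by simpa using two_le_infty)) v w

end TestFunctions

/-! ### Averages of rapidly oscillating integrals. -/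

section Oscillation

set_option linter.unusedSectionVars false

variable {E : Type*} [NormedAddCommGroup E] [NormedSpace ℝ E] [MeasurableSpace E]
  [BorelSpace E] [FiniteDimensional ℝ E] {μ : Measure E} [μ.IsAddHaarMeasure]
  {K : Set E} {f g : E → ℝ}

theorem IsTest.integrable (hf : IsTest K f) (hK : IsCompact K) : Integrable f μ :=
  hf.continuous.integrable_of_hasCompactSupport (hf.hasCompactSupport hK)

theorem IsTest.integral_dirDeriv (hf : IsTest K f) (hK : IsCompact K) (v : E) :
    ∫ x, dirDeriv v f x ∂μ = 0 := by
  have h1 : Integrable (dirDeriv v f) μ := (hf.along hK.isClosed v).integrable hK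
  have := integral_mul_fderiv_eq_neg_fderiv_mul_of_integrable (μ := μ) (f := fun _ : E => (1 : ℝ))
    (g := f) (v := v) (by simp) (by simpa using! h1)
    (by simpa using hf.integrable hK) (fun x _ => differentiableAt_const _)
    (fun x _ => hf.differentiable x)
  simpa [dirDeriv] using this

theorem abs_integral_le_of_vanishing (hK : IsCompact K) {C : ℝ}
    (hf : ∀ x, x ∉ K → f x = 0) (hC : ∀ x, |f x| ≤ C) : |∫ x, f x ∂μ| ≤ C * μ.real K := by
  rw [← setIntegral_eq_integral_of_forall_compl_eq_zero hf]
  exact norm_setIntegral_le_of_norm_le_const (f := f) hK.measure_lt_top fun x _ => hC x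

/-- Riemann–Lebesgue: one integration by parts along `v`, where the phase has nonzero slope, gains a
factor `1 / N`. -/
theorem tendsto_integral_mul_cos (hf : IsTest K f) (hK : IsCompact K) {a : E →L[ℝ] ℝ} {v : E}
    {b : ℝ} (hb : b ≠ 0) (ha : a v = b) :
    Tendsto (fun N : ℝ => ∫ x, f x * Real.cos (N * a x) ∂μ) atTop (𝓝 0) := by
  have hd := hf.along hK.isClosed v
  obtain ⟨C, hC0, hC⟩ := hd.exists_bound hK
  have key : ∀ N : ℝ, 0 < N → ∫ x, f x * Real.cos (N * a x) ∂μ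
      = -(N⁻¹ * b⁻¹) * ∫ x, dirDeriv v f x * Real.sin (N * a x) ∂μ := by
    intro N hN
    have h0 := (hf.mul_contDiff (contDiff_sin_mul a N)).integral_dirDeriv (μ := μ) hK v
    have h1 : ∀ x, dirDeriv v (fun x => f x * Real.sin (N * a x)) x =
        dirDeriv v f x * Real.sin (N * a x) + (N * b) * (f x * Real.cos (N * a x)) := by
      intro x
      rw [dirDeriv_mul hf.differentiable ((contDiff_sin_mul a N).differentiable (by simp)),
        dirDeriv_sin, ha]
      ring
    simp_rw [h1] at h0
    rw [integral_add ((hd.mul_contDiff (contDiff_sin_mul a N)).integrable hK)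
      (((hf.mul_contDiff (contDiff_cos_mul a N)).const_mul _).integrable hK),
      integral_const_mul] at h0
    rw [eq_neg_of_add_eq_zero_left h0]
    field_simp
  refine squeeze_zero_norm' (a := fun N : ℝ => |b⁻¹| * (C * μ.real K) * N⁻¹) ?_ ?_
  · filter_upwards [eventually_gt_atTop 0] with N hN
    rw [key N hN, norm_mul, norm_neg, norm_mul, Real.norm_eq_abs, Real.norm_eq_abs, abs_of_pos
      (inv_pos.2 hN)]
    have : ‖∫ x, dirDeriv v f x * Real.sin (N * a x) ∂μ‖ ≤ C * μ.real K := by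
      refine abs_integral_le_of_vanishing hK
        (hd.mul_contDiff (contDiff_sin_mul a N)).eq_zero fun x => ?_
      rw [abs_mul]
      calc |dirDeriv v f x| * |Real.sin (N * a x)| ≤ C * 1 :=
            mul_le_mul (hC x) (Real.abs_sin_le_one _) (abs_nonneg _) hC0
        _ = C := mul_one C
    calc N⁻¹ * |b⁻¹| * ‖∫ x, dirDeriv v f x * Real.sin (N * a x) ∂μ‖
        ≤ N⁻¹ * |b⁻¹| * (C * μ.real K) := by gcongr
      _ = |b⁻¹| * (C * μ.real K) * N⁻¹ := by ring
  · simpa using tendsto_inv_atTop_zero.const_mul (|b⁻¹| * (C * μ.real K))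

theorem tendsto_integral_mul_cos_sq (hf : IsTest K f) (hK : IsCompact K) {a : E →L[ℝ] ℝ} {v : E}
    (ha : a v = 1) :
    Tendsto (fun N : ℝ => ∫ x, f x * Real.cos (N * a x) ^ 2 ∂μ) atTop
      (𝓝 ((∫ x, f x ∂μ) / 2)) := by
  have h2 : (((2 : ℝ) • a) v) = 2 := by simp [ha]
  have h := (tendsto_integral_mul_cos (μ := μ) hf hK two_ne_zero h2).const_mul (1 / 2)
  have key : ∀ N : ℝ, ∫ x, f x * Real.cos (N * a x) ^ 2 ∂μ = (∫ x, f x ∂μ) / 2 +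
      1 / 2 * ∫ x, f x * Real.cos (N * ((2 : ℝ) • a) x) ∂μ := by
    intro N
    have hi : Integrable (fun x => f x * Real.cos (N * ((2 : ℝ) • a) x)) μ :=
      (hf.mul_contDiff (contDiff_cos_mul _ N)).integrable hK
    rw [← integral_const_mul, ← integral_div, ← integral_add ((hf.integrable hK).div_const _)
      (hi.const_mul _)]
    congr 1
    funext x
    rw [Real.cos_sq]
    simp only [smul_apply, smul_eq_mul]
    rw [show 2 * (N * a x) = N * (2 * a x) by ring]
    ring
  simp_rw [key]
  simpa using h.const_add ((∫ x, f x ∂μ) / 2)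

end Oscillation

/-! ### Leading-order derivatives of high-frequency waves. -/

section UniformApproximation

variable {E : Type*} [NormedAddCommGroup E] [NormedSpace ℝ E] {K : Set E} {f : E → ℝ}

theorem dirDeriv_cos_wave (hf : Differentiable ℝ f) (a : E →L[ℝ] ℝ) (c : ℝ) (N : ℝ) (v : E) :
    dirDeriv v (fun x => c * (f x * Real.cos (N * a x))) = fun x =>
      c * (dirDeriv v f x * Real.cos (N * a x)) - c * N * a v * (f x * Real.sin (N * a x)) := by
  have hc := (contDiff_cos_mul a N).differentiable (by simp)
  funext x
  rw [dirDeriv_const_mul (hf.fun_mul hc), dirDeriv_mul hf hc, dirDeriv_cos]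
  ring

theorem dirDeriv_sin_wave (hf : Differentiable ℝ f) (a : E →L[ℝ] ℝ) (c : ℝ) (N : ℝ) (v : E) :
    dirDeriv v (fun x => c * (f x * Real.sin (N * a x))) = fun x =>
      c * (dirDeriv v f x * Real.sin (N * a x)) + c * N * a v * (f x * Real.cos (N * a x)) := by
  have hc := (contDiff_sin_mul a N).differentiable (by simp)
  funext x
  rw [dirDeriv_const_mul (hf.fun_mul hc), dirDeriv_mul hf hc, dirDeriv_sin]
  ring

theorem eventually_le_div {ε : ℝ} (hε : 0 < ε) (C : ℝ) : ∀ᶠ N : ℝ in atTop, C / N < ε :=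
  (tendsto_const_nhds.div_atTop tendsto_id).eventually_lt_const hε

theorem eventually_dirDeriv_sin_wave (hf : IsTest K f) (hK : IsCompact K) (a : E →L[ℝ] ℝ) (v : E)
    {ε : ℝ} (hε : 0 < ε) :
    ∀ᶠ N : ℝ in atTop, ∀ x, |dirDeriv v (fun x => N⁻¹ * (f x * Real.sin (N * a x))) x
      - a v * (f x * Real.cos (N * a x))| < ε := by
  obtain ⟨C, hC0, hC⟩ := (hf.along hK.isClosed v).exists_bound hK
  filter_upwards [eventually_le_div hε C, eventually_gt_atTop 0] with N hN hN0 x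
  rw [dirDeriv_sin_wave hf.differentiable]
  have h : N⁻¹ * (dirDeriv v f x * Real.sin (N * a x)) + N⁻¹ * N * a v *
      (f x * Real.cos (N * a x)) - a v * (f x * Real.cos (N * a x)) =
      dirDeriv v f x * Real.sin (N * a x) / N := by
    field_simp
    ring
  rw [h, abs_div, abs_of_pos hN0, abs_mul]
  refine lt_of_le_of_lt ?_ hN
  gcongr
  calc |dirDeriv v f x| * |Real.sin (N * a x)| ≤ C * 1 :=
        mul_le_mul (hC x) (Real.abs_sin_le_one _) (abs_nonneg _) hC0
    _ = C := mul_one C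

/-- The factor `N⁻²` is compensated only when both derivatives fall on the cosine, which also
produces the sign; all other terms are uniformly `O(1 / N)`. -/
theorem eventually_dirDeriv_dirDeriv_cos_wave (hf : IsTest K f) (hK : IsCompact K)
    (a : E →L[ℝ] ℝ) (v w : E) {ε : ℝ} (hε : 0 < ε) :
    ∀ᶠ N : ℝ in atTop, ∀ x,
      |dirDeriv v (dirDeriv w (fun x => (N ^ 2)⁻¹ * (f x * Real.cos (N * a x)))) x
      + a v * a w * (f x * Real.cos (N * a x))| < ε := by
  have hv := hf.along hK.isClosed v
  have hw := hf.along hK.isClosed w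
  obtain ⟨C₁, hC₁0, hC₁⟩ := hv.exists_bound hK
  obtain ⟨C₂, hC₂0, hC₂⟩ := hw.exists_bound hK
  obtain ⟨C₃, hC₃0, hC₃⟩ := (hw.along hK.isClosed v).exists_bound hK
  filter_upwards [eventually_le_div hε (C₃ + |a v| * C₂ + |a w| * C₁), eventually_ge_atTop 1]
    with N hN hN1 x
  have hN0 : 0 < N := by linarith
  rw [dirDeriv_cos_wave hf.differentiable, dirDeriv_sub
    ((hw.mul_contDiff (contDiff_cos_mul a N)).const_mul _).differentiable
    ((hf.mul_contDiff (contDiff_sin_mul a N)).const_mul _).differentiable,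
    dirDeriv_cos_wave hw.differentiable, dirDeriv_sin_wave hf.differentiable]
  have h : (N ^ 2)⁻¹ * (dirDeriv v (dirDeriv w f) x * Real.cos (N * a x)) -
        (N ^ 2)⁻¹ * N * a v * (dirDeriv w f x * Real.sin (N * a x)) -
      ((N ^ 2)⁻¹ * N * a w * (dirDeriv v f x * Real.sin (N * a x)) +
        (N ^ 2)⁻¹ * N * a w * N * a v * (f x * Real.cos (N * a x))) +
      a v * a w * (f x * Real.cos (N * a x)) =
      (dirDeriv v (dirDeriv w f) x * Real.cos (N * a x) / N
        - a v * (dirDeriv w f x * Real.sin (N * a x))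
        - a w * (dirDeriv v f x * Real.sin (N * a x))) / N := by
    field_simp
    ring
  rw [h, abs_div, abs_of_pos hN0]
  refine lt_of_le_of_lt ?_ hN
  gcongr
  have h1 : |dirDeriv v (dirDeriv w f) x * Real.cos (N * a x) / N| ≤ C₃ := by
    rw [abs_div, abs_of_pos hN0, div_le_iff₀ hN0, abs_mul]
    exact mul_le_mul (hC₃ x) ((Real.abs_cos_le_one _).trans hN1) (abs_nonneg _) hC₃0
  have h2 : |a v * (dirDeriv w f x * Real.sin (N * a x))| ≤ |a v| * C₂ := by
    rw [abs_mul, abs_mul]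
    refine mul_le_mul_of_nonneg_left ?_ (abs_nonneg _)
    simpa using mul_le_mul (hC₂ x) (Real.abs_sin_le_one (N * a x)) (abs_nonneg _) hC₂0
  have h3 : |a w * (dirDeriv v f x * Real.sin (N * a x))| ≤ |a w| * C₁ := by
    rw [abs_mul, abs_mul]
    refine mul_le_mul_of_nonneg_left ?_ (abs_nonneg _)
    simpa using mul_le_mul (hC₁ x) (Real.abs_sin_le_one (N * a x)) (abs_nonneg _) hC₁0
  exact (abs_sub _ _).trans (add_le_add ((abs_sub _ _).trans (add_le_add h1 h2)) h3)

variable [MeasurableSpace E] [BorelSpace E] {μ : Measure E} [IsFiniteMeasureOnCompacts μ]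

theorem tendsto_integral_mul_sub_integral_mul {ι : Type*} {l : Filter ι} (hK : IsCompact K)
    {U U' V V' : ι → E → ℝ} (hU : ∀ N, IsTest K (U N)) (hU' : ∀ N, IsTest K (U' N))
    (hV : ∀ N, IsTest K (V N)) (hV' : ∀ N, IsTest K (V' N)) {C : ℝ}
    (hUC : ∀ N x, |U N x| ≤ C) (hVC : ∀ N x, |V N x| ≤ C)
    (hUU' : ∀ ε > 0, ∀ᶠ N in l, ∀ x, |U' N x - U N x| < ε)
    (hVV' : ∀ ε > 0, ∀ᶠ N in l, ∀ x, |V' N x - V N x| < ε) :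
    Tendsto (fun N => ∫ x, U' N x * V' N x ∂μ - ∫ x, U N x * V N x ∂μ) l (𝓝 0) := by
  rw [Metric.tendsto_nhds]
  intro ε hε
  set D : ℝ := |C| with hD
  have hm : 0 ≤ μ.real K := measureReal_nonneg
  have hden : 0 < (2 * D + 1) * (μ.real K + 1) := by positivity
  -- The bound `1` makes the product of the two errors at most linear in `η`.
  set η := min 1 (ε / ((2 * D + 1) * (μ.real K + 1))) with hη
  have hη0 : 0 < η := by positivity
  filter_upwards [hUU' η hη0, hVV' η hη0] with N h1 h2
  have hi : ∀ {f g : E → ℝ}, IsTest K f → IsTest K g → Integrable (fun x => f x * g x) μ :=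
    fun hf hg => (hf.mul hg).continuous.integrable_of_hasCompactSupport
      ((hf.mul hg).hasCompactSupport hK)
  rw [Real.dist_eq, sub_zero, ← integral_sub (hi (hU' N) (hV' N)) (hi (hU N) (hV N))]
  have hb : ∀ x, |U' N x * V' N x - U N x * V N x| ≤ (2 * D + 1) * η := by
    intro x
    have e1 : U' N x * V' N x - U N x * V N x =
      (U N x + (U' N x - U N x)) * (V' N x - V N x) + (U' N x - U N x) * V N x := by ring
    have hu : |U N x| ≤ D := (hUC N x).trans (le_abs_self C)
    have hv : |V N x| ≤ D := (hVC N x).trans (le_abs_self C)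
    have h3 : |U N x + (U' N x - U N x)| ≤ D + 1 :=
      (abs_add_le _ _).trans (add_le_add hu ((h1 x).le.trans (min_le_left _ _)))
    rw [e1]
    refine (abs_add_le _ _).trans ?_
    rw [abs_mul, abs_mul]
    calc _ ≤ (D + 1) * η + η * D := by
          gcongr
          · exact (h2 x).le
          · exact (h1 x).le
      _ = (2 * D + 1) * η := by ring
  have hz : ∀ x, x ∉ K → U' N x * V' N x - U N x * V N x = 0 := fun x hx => by
    rw [(hU' N).eq_zero x hx, (hU N).eq_zero x hx]; ring
  have hle : |∫ x, (U' N x * V' N x - U N x * V N x) ∂μ| ≤ (2 * D + 1) * η * μ.real K := by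
    rw [← setIntegral_eq_integral_of_forall_compl_eq_zero hz]
    exact norm_setIntegral_le_of_norm_le_const
      (f := fun x => U' N x * V' N x - U N x * V N x) hK.measure_lt_top fun x _ => hb x
  refine hle.trans_lt ?_
  calc (2 * D + 1) * η * μ.real K < (2 * D + 1) * η * (μ.real K + 1) := by
        gcongr; linarith
    _ ≤ (2 * D + 1) * (ε / ((2 * D + 1) * (μ.real K + 1))) * (μ.real K + 1) := by
        gcongr; exact min_le_right _ _
    _ = ε := by
        have hD1 : 2 * D + 1 ≠ 0 := by positivity
        field_simp

end UniformApproximation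

/-! ### One factor of the Riesz product. -/

section WavePacket

set_option linter.unusedSectionVars false

variable {E : Type*} [NormedAddCommGroup E] [NormedSpace ℝ E] [MeasurableSpace E]
  [BorelSpace E] [FiniteDimensional ℝ E] {μ : Measure E} [μ.IsAddHaarMeasure]
  {ι : Type*} {e : ι → E} {i₀ i₁ : ι} {K : Set E} {χ : E → ℝ}

theorem tendsto_integral_quadratic_cos {f₀ f₁ f₂ : E → ℝ} (h₀ : IsTest K f₀) (h₁ : IsTest K f₁)
    (h₂ : IsTest K f₂) (hK : IsCompact K) {a : E →L[ℝ] ℝ} {v : E} (ha : a v = 1) :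
    Tendsto (fun N : ℝ => ∫ x, (f₀ x + f₁ x * Real.cos (N * a x) + f₂ x * Real.cos (N * a x) ^ 2) ∂μ)
      atTop (𝓝 (∫ x, f₀ x ∂μ + (∫ x, f₂ x ∂μ) / 2)) := by
  have hi₁ : ∀ N : ℝ, Integrable (fun x => f₁ x * Real.cos (N * a x)) μ := fun N =>
    (h₁.mul_contDiff (contDiff_cos_mul a N)).integrable hK
  have hi₂ : ∀ N : ℝ, Integrable (fun x => f₂ x * Real.cos (N * a x) ^ 2) μ := fun N =>
    (h₂.mul_contDiff ((contDiff_cos_mul a N).pow 2)).integrable hK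
  have hi₀ : Integrable f₀ μ := h₀.integrable hK
  have h : ∀ N : ℝ,
      ∫ x, (f₀ x + f₁ x * Real.cos (N * a x) + f₂ x * Real.cos (N * a x) ^ 2) ∂μ =
      ∫ x, f₀ x ∂μ + ∫ x, f₁ x * Real.cos (N * a x) ∂μ +
        ∫ x, f₂ x * Real.cos (N * a x) ^ 2 ∂μ := by
    intro N
    rw [integral_add (f := fun x => f₀ x + f₁ x * Real.cos (N * a x)) (hi₀.add (hi₁ N)) (hi₂ N),
      integral_add hi₀ (hi₁ N)]
  simp_rw [h]
  simpa using (tendsto_const_nhds.add (tendsto_integral_mul_cos h₁ hK one_ne_zero ha)).add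
    (tendsto_integral_mul_cos_sq h₂ hK ha)

variable (μ e i₀ i₁ K χ) in
/-- Approximate state of the iterative construction of a counterexample to the `L¹` estimate of
`∂₀∂₁ g` by `∂₀∂₀ g` and `∂₁∂₁ g`: both pure second derivatives are close to `P - χ`
with `P ≥ 0` a Riesz product, while `∂₀ w` is close to the bounded function `F` and the pairing of
`∂₀ w` with `∂₀∂₁ g` is close to `T`. -/
structure IsWavePacket (r A B T δ : ℝ) (P F G g w : E → ℝ) : Prop where
  test_P : IsTest K P
  test_F : IsTest K F
  test_G : IsTest K G
  test_g : IsTest K g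
  test_w : IsTest K w
  nonneg : ∀ x, 0 ≤ P x
  sq_le : ∀ x, F x ^ 2 + G x ^ 2 ≤ r
  mass : |∫ x, P x ∂μ - ∫ x, χ x ∂μ| < δ
  corr_G : |∫ x, G x * P x ∂μ - A| < δ
  corr_F : |∫ x, F x * P x ∂μ - B| < δ
  pairing : |∫ x, dirDeriv (e i₀) w x * dirDeriv (e i₀) (dirDeriv (e i₁) g) x ∂μ - T| < δ
  pure₀ : ∀ x, |dirDeriv (e i₀) (dirDeriv (e i₀) g) x - (P x - χ x)| < δ
  pure₁ : ∀ x, |dirDeriv (e i₁) (dirDeriv (e i₁) g) x - (P x - χ x)| < δ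
  mixed : ∀ i, i ≠ i₀ → i ≠ i₁ → ∀ x, |dirDeriv (e i₀) (dirDeriv (e i) g) x| < δ
  deriv_w : ∀ x, |dirDeriv (e i₀) w x - F x| < δ
  deriv_w_other : ∀ i, i ≠ i₀ → i ≠ i₁ → ∀ x, |dirDeriv (e i) w x| < δ

theorem dirDeriv_dirDeriv_sub {f g : E → ℝ} {L : Set E} (hL : IsClosed L) (hf : IsTest L f)
    (hg : IsTest L g) (v w x : E) :
    dirDeriv v (dirDeriv w (fun x => f x - g x)) x =
      dirDeriv v (dirDeriv w f) x - dirDeriv v (dirDeriv w g) x := by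
  rw [show dirDeriv w (fun x => f x - g x) = fun x => dirDeriv w f x - dirDeriv w g x from
    funext (dirDeriv_sub hf.differentiable hg.differentiable w),
    dirDeriv_sub (hf.along hL w).differentiable (hg.along hL w).differentiable]

/-- Multiply `P` by `1 + cos(Na)` and `G + iF` by `1 + icτ cos(Na)`, and correct `g` and `w` by
waves whose leading derivatives are these increments. As `N → ∞` terms linear in the cosine average
out and `cos²` averages to `1 / 2`, which gives the new `A`, `B`, `T`. Since `τ² = 1`, both pure
second derivatives change by the same `P cos(Na)`. -/
theorem IsWavePacket.step [Finite ι] (hK : IsCompact K) {c τ : ℝ} (hτ : τ ^ 2 = 1)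
    {a : E →L[ℝ] ℝ} (ha₀ : a (e i₀) = 1) (ha₁ : a (e i₁) = τ)
    (ha : ∀ i, i ≠ i₀ → i ≠ i₁ → a (e i) = 0) {r A B T δ : ℝ} (hδ : 0 < δ) {P F G g w : E → ℝ}
    (h : IsWavePacket μ e i₀ i₁ K χ r A B T (δ / (2 * (1 + |c|))) P F G g w) :
    ∃ P' F' G' g' w' : E → ℝ, IsWavePacket μ e i₀ i₁ K χ (r * (1 + c ^ 2))
      (A - c * τ / 2 * B) (B + c * τ / 2 * A) (T + c / 2 * A) δ P' F' G' g' w' := by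
  -- The updates of `A`, `B`, `T` combine an old error with at most `|c|` times another; pointwise
  -- bounds add one old and one new error. Both totals fit into `2 * (1 + |c|) * δ' = δ`.
  set δ' := δ / (2 * (1 + |c|)) with hδ'
  have hc0 : 0 ≤ |c| := abs_nonneg c
  have hδ'0 : 0 < δ' := by positivity
  have hδδ : δ' * (2 * (1 + |c|)) = δ := by rw [hδ']; field_simp
  have hτa : |τ| = 1 := 
    (pow_eq_one_iff_of_nonneg (abs_nonneg τ) two_ne_zero).1 (by rw [sq_abs, hτ])
  have hcτ : |c * τ / 2| = |c| / 2 := by rw [abs_div, abs_mul, hτa]; norm_num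
  have hK' := hK.isClosed
  set C : ℝ → E → ℝ := fun N x => Real.cos (N * a x) with hC
  have hCs : ∀ N, ContDiff ℝ (⊤ : ℕ∞) (C N) := fun N => contDiff_cos_mul a N
  set P' : ℝ → E → ℝ := fun N x => P x + P x * C N x with hP'
  set F' : ℝ → E → ℝ := fun N x => F x + c * τ * (G x * C N x) with hF'
  set G' : ℝ → E → ℝ := fun N x => G x - c * τ * (F x * C N x) with hG'
  set g' : ℝ → E → ℝ := fun N x => g x - (N ^ 2)⁻¹ * (P x * C N x) with hg'
  set w' : ℝ → E → ℝ := fun N x => w x + c * τ * (N⁻¹ * (G x * Real.sin (N * a x))) with hw'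
  have tP' : ∀ N, IsTest K (P' N) := fun N => h.test_P.add (h.test_P.mul_contDiff (hCs N))
  have tF' : ∀ N, IsTest K (F' N) := fun N =>
    h.test_F.add ((h.test_G.mul_contDiff (hCs N)).const_mul _)
  have tG' : ∀ N, IsTest K (G' N) := fun N =>
    h.test_G.sub ((h.test_F.mul_contDiff (hCs N)).const_mul _)
  have tq : ∀ N, IsTest K (fun x => (N ^ 2)⁻¹ * (P x * C N x)) := fun N =>
    (h.test_P.mul_contDiff (hCs N)).const_mul _
  have ts : ∀ N, IsTest K (fun x => N⁻¹ * (G x * Real.sin (N * a x))) := fun N =>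
    (h.test_G.mul_contDiff (contDiff_sin_mul a N)).const_mul _
  have tg' : ∀ N, IsTest K (g' N) := fun N => h.test_g.sub (tq N)
  have tw' : ∀ N, IsTest K (w' N) := fun N => h.test_w.add ((ts N).const_mul _)
  have dg' : ∀ N v u x, dirDeriv v (dirDeriv u (g' N)) x = dirDeriv v (dirDeriv u g) x -
      dirDeriv v (dirDeriv u (fun x => (N ^ 2)⁻¹ * (P x * C N x))) x := fun N v u x =>
    dirDeriv_dirDeriv_sub hK' h.test_g (tq N) v u x
  have dw' : ∀ N v x, dirDeriv v (w' N) x = dirDeriv v w x +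
      c * τ * dirDeriv v (fun x => N⁻¹ * (G x * Real.sin (N * a x))) x := fun N v x => by
    rw [hw', dirDeriv_add h.test_w.differentiable ((ts N).const_mul _).differentiable,
      dirDeriv_const_mul (ts N).differentiable]
  have ug : ∀ v u {ε : ℝ}, 0 < ε → ∀ᶠ N : ℝ in atTop, ∀ x,
      |dirDeriv v (dirDeriv u (g' N)) x -
        (dirDeriv v (dirDeriv u g) x + a v * a u * (P x * C N x))| < ε := by
    intro v u ε hε
    filter_upwards [eventually_dirDeriv_dirDeriv_cos_wave h.test_P hK a v u hε] with N hN x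
    rw [dg', abs_sub_comm]
    convert hN x using 2
    ring
  have uw : ∀ v {ε : ℝ}, 0 < ε → ∀ᶠ N : ℝ in atTop, ∀ x,
      |dirDeriv v (w' N) x - (dirDeriv v w x + c * τ * (a v * (G x * C N x)))| < ε := by
    intro v ε hε
    have hη : 0 < ε / (1 + |c|) := by positivity
    filter_upwards [eventually_dirDeriv_sin_wave h.test_G hK a v hη] with N hN x
    rw [dw', add_sub_add_left_eq_sub, ← mul_sub, abs_mul, abs_mul, hτa, mul_one]
    have h1 := hN x
    rw [lt_div_iff₀ (by positivity)] at h1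
    have h2 := abs_nonneg (dirDeriv v (fun x => N⁻¹ * (G x * Real.sin (N * a x))) x -
      a v * (G x * C N x))
    nlinarith
  have lim_mass : Tendsto (fun N => ∫ x, P' N x ∂μ) atTop (𝓝 (∫ x, P x ∂μ)) := by
    have := tendsto_integral_quadratic_cos (μ := μ) h.test_P h.test_P (IsTest.zero K) hK ha₀
    simpa [hP', hC] using this
  have lim_G : Tendsto (fun N => ∫ x, G' N x * P' N x ∂μ) atTop
      (𝓝 (∫ x, G x * P x ∂μ - c * τ / 2 * ∫ x, F x * P x ∂μ)) := by
    have := tendsto_integral_quadratic_cos (μ := μ) (h.test_G.mul h.test_P)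
      ((h.test_G.mul h.test_P).sub ((h.test_F.mul h.test_P).const_mul (c * τ)))
      ((h.test_F.mul h.test_P).const_mul (-(c * τ))) hK ha₀
    convert this using 3
    · funext x; simp only [hG', hP', hC]; ring
    · rw [integral_const_mul]; ring
  have lim_F : Tendsto (fun N => ∫ x, F' N x * P' N x ∂μ) atTop
      (𝓝 (∫ x, F x * P x ∂μ + c * τ / 2 * ∫ x, G x * P x ∂μ)) := by
    have := tendsto_integral_quadratic_cos (μ := μ) (h.test_F.mul h.test_P)
      ((h.test_F.mul h.test_P).add ((h.test_G.mul h.test_P).const_mul (c * τ)))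
      ((h.test_G.mul h.test_P).const_mul (c * τ)) hK ha₀
    convert this using 3
    · funext x; simp only [hF', hP', hC]; ring
    · rw [integral_const_mul]; ring
  set X := dirDeriv (e i₀) w with hX
  set Y := dirDeriv (e i₀) (dirDeriv (e i₁) g) with hY
  have tX : IsTest K X := h.test_w.along hK' _
  have tY : IsTest K Y := (h.test_g.along hK' _).along hK' _
  have lim_T : Tendsto (fun N => ∫ x, dirDeriv (e i₀) (w' N) x *
      dirDeriv (e i₀) (dirDeriv (e i₁) (g' N)) x ∂μ) atTop
      (𝓝 (∫ x, X x * Y x ∂μ + c / 2 * ∫ x, G x * P x ∂μ)) := by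
    have main := tendsto_integral_quadratic_cos (μ := μ) (tX.mul tY)
      (((tX.mul h.test_P).const_mul τ).add ((h.test_G.mul tY).const_mul (c * τ)))
      ((h.test_G.mul h.test_P).const_mul c) hK ha₀
    obtain ⟨C₁, hC₁0, hC₁⟩ := tX.exists_bound hK
    obtain ⟨C₂, hC₂0, hC₂⟩ := tY.exists_bound hK
    obtain ⟨C₃, hC₃0, hC₃⟩ := h.test_G.exists_bound hK
    obtain ⟨C₄, hC₄0, hC₄⟩ := h.test_P.exists_bound hK
    have hcos : ∀ N x, |C N x| ≤ 1 := fun N x => Real.abs_cos_le_one _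
    -- Both factors are replaced by their leading parts, which are bounded uniformly in `N`; their
    -- product is quadratic in the cosine, with `cos²` coefficient `cτ²GP = cGP`.
    have err := tendsto_integral_mul_sub_integral_mul (μ := μ) (l := atTop) hK
      (U := fun N x => X x + c * τ * (G x * C N x)) (U' := fun N => dirDeriv (e i₀) (w' N))
      (V := fun N x => Y x + τ * (P x * C N x))
      (V' := fun N => dirDeriv (e i₀) (dirDeriv (e i₁) (g' N)))
      (C := C₁ + |c| * C₃ + C₂ + C₄)
      (fun N => tX.add ((h.test_G.mul_contDiff (hCs N)).const_mul _))
      (fun N => (tw' N).along hK' _)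
      (fun N => tY.add ((h.test_P.mul_contDiff (hCs N)).const_mul _))
      (fun N => ((tg' N).along hK' _).along hK' _)
      (fun N x => by
        refine (abs_add_le _ _).trans ?_
        rw [abs_mul, abs_mul, abs_mul, hτa]
        have : |G x| * |C N x| ≤ C₃ * 1 := mul_le_mul (hC₃ x) (hcos N x) (abs_nonneg _) hC₃0
        have := mul_le_mul_of_nonneg_left this hc0
        linarith [hC₁ x])
      (fun N x => by
        refine (abs_add_le _ _).trans ?_
        rw [abs_mul, abs_mul, hτa]
        have : |P x| * |C N x| ≤ C₄ * 1 := mul_le_mul (hC₄ x) (hcos N x) (abs_nonneg _) hC₄0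
        have := mul_nonneg hc0 hC₃0
        linarith [hC₂ x])
      (fun ε hε => by
        filter_upwards [uw (e i₀) hε] with N hN x
        simpa [ha₀] using hN x)
      (fun ε hε => by
        filter_upwards [ug (e i₀) (e i₁) hε] with N hN x
        simpa [ha₀, ha₁] using hN x)
    have := err.add main
    convert this using 2 with N
    · rw [sub_add_eq_add_sub, eq_sub_iff_add_eq]
      congr 1
      congr 1
      funext x
      simp only [hC]
      linear_combination (c * G x * P x * Real.cos (N * a x) ^ 2) * hτ
    · rw [integral_const_mul]; ring_nf
  have ev_mixed : ∀ᶠ N in atTop, ∀ i, i ≠ i₀ → i ≠ i₁ → ∀ x,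
      |dirDeriv (e i₀) (dirDeriv (e i) (g' N)) x| < δ := by
    refine eventually_all.2 fun i => ?_
    filter_upwards [ug (e i₀) (e i) hδ'0] with N hN hi₀ hi₁ x
    have h1 := hN x
    rw [ha i hi₀ hi₁] at h1
    have h2 := h.mixed i hi₀ hi₁ x
    rw [abs_lt] at h1 h2 ⊢
    constructor <;> nlinarith
  have ev_w : ∀ᶠ N in atTop, ∀ i, i ≠ i₀ → i ≠ i₁ → ∀ x, |dirDeriv (e i) (w' N) x| < δ := by
    refine eventually_all.2 fun i => ?_
    filter_upwards [uw (e i) hδ'0] with N hN hi₀ hi₁ x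
    have h1 := hN x
    rw [ha i hi₀ hi₁] at h1
    have h2 := h.deriv_w_other i hi₀ hi₁ x
    rw [abs_lt] at h1 h2 ⊢
    constructor <;> nlinarith
  have near : ∀ {u : ℝ → ℝ} {l m : ℝ}, Tendsto u atTop (𝓝 l) → |l - m| < δ →
      ∀ᶠ N in atTop, |u N - m| < δ := fun hu hl =>
    ((hu.sub_const _).abs).eventually_lt_const hl
  have comb : ∀ {x y x₀ y₀ s : ℝ}, |x - x₀| < δ' → |y - y₀| < δ' → |s| ≤ |c| →
      |x + s * y - (x₀ + s * y₀)| < δ := by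
    intro x y x₀ y₀ s hx hy hs
    calc |x + s * y - (x₀ + s * y₀)| = |(x - x₀) + s * (y - y₀)| := by ring_nf
      _ ≤ |x - x₀| + |s| * |y - y₀| := by rw [← abs_mul]; exact abs_add_le _ _
      _ < δ' + |c| * δ' + δ' := by
        have : |s| * |y - y₀| ≤ |c| * δ' := mul_le_mul hs hy.le (abs_nonneg _) hc0
        linarith
      _ ≤ δ := by rw [← hδδ]; nlinarith
  have hc2 : |c| / 2 ≤ |c| := by linarith
  have ev_G := near lim_G (m := A - c * τ / 2 * B) (by
    have := comb h.corr_G h.corr_F (s := -(c * τ / 2)) (by rw [abs_neg, hcτ]; exact hc2)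
    simpa only [neg_mul, ← sub_eq_add_neg] using this)
  have ev_F := near lim_F (comb h.corr_F h.corr_G (s := c * τ / 2) (by rw [hcτ]; exact hc2))
  have ev_T := near lim_T (comb h.pairing h.corr_G (s := c / 2)
    (by rw [abs_div, abs_two]; exact hc2))
  have hδlt : δ' + δ' ≤ δ := by rw [← hδδ]; nlinarith
  have ev_mass := near lim_mass (lt_of_lt_of_le h.mass (by linarith))
  obtain ⟨N, nG, nF, nT, nM, n00, n11, nmix, nw, nwo⟩ :=
    (ev_G.and (ev_F.and (ev_T.and (ev_mass.and ((ug (e i₀) (e i₀) hδ'0).and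
      ((ug (e i₁) (e i₁) hδ'0).and (ev_mixed.and ((uw (e i₀) hδ'0).and ev_w)))))))).exists
  refine ⟨P' N, F' N, G' N, g' N, w' N, tP' N, tF' N, tG' N, tg' N, tw' N, fun x => ?_,
    fun x => ?_, nM, nG, nF, nT, fun x => ?_, fun x => ?_, nmix, fun x => ?_, nwo⟩
  · have h1 : -1 ≤ C N x := Real.neg_one_le_cos _
    simp only [hP']
    nlinarith [h.nonneg x]
  · have h1 : C N x ^ 2 ≤ 1 := Real.cos_sq_le_one _
    -- Multiplicativity of the complex modulus.
    have h2 : F' N x ^ 2 + G' N x ^ 2 = (F x ^ 2 + G x ^ 2) * (1 + c ^ 2 * C N x ^ 2) := by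
      simp only [hF', hG']
      linear_combination (c ^ 2 * C N x ^ 2 * (F x ^ 2 + G x ^ 2)) * hτ
    rw [h2]
    have h3 : c ^ 2 * C N x ^ 2 ≤ c ^ 2 := mul_le_of_le_one_right (sq_nonneg c) h1
    exact mul_le_mul (h.sq_le x) (by linarith) (by positivity)
      (le_trans (by positivity) (h.sq_le x))
  · have h1 := n00 x
    have h2 := h.pure₀ x
    rw [ha₀] at h1
    simp only [hP']
    rw [abs_lt] at h1 h2 ⊢
    constructor <;> linarith
  · have h1 := n11 x
    have h2 := h.pure₁ x
    rw [ha₁, ← sq, hτ] at h1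
    simp only [hP']
    rw [abs_lt] at h1 h2 ⊢
    constructor <;> linarith
  · have h1 := nw x
    have h2 := h.deriv_w x
    rw [ha₀] at h1
    simp only [hF']
    rw [abs_lt] at h1 h2 ⊢
    constructor <;> linarith

end WavePacket

/-! ### Iteration of the construction and failure of the L¹ estimate. -/

section L1Estimate

set_option linter.unusedSectionVars false

variable {E : Type*} [NormedAddCommGroup E] [NormedSpace ℝ E] [MeasurableSpace E]
  [BorelSpace E] [FiniteDimensional ℝ E] {μ : Measure E} [μ.IsAddHaarMeasure]
  {ι : Type*} {e : ι → E} {p : ι → E →L[ℝ] ℝ} {i₀ i₁ : ι} {K : Set E} {χ : E → ℝ}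

variable (μ e i₀ i₁ K χ) in
/-- There are wave packets with the given parameters up to arbitrarily small errors. -/
def HasWavePackets (r A B T : ℝ) : Prop :=
  ∀ δ > 0, ∃ P F G g w : E → ℝ, IsWavePacket μ e i₀ i₁ K χ r A B T δ P F G g w

theorem hasWavePackets_initial (hχ : IsTest K χ) (h0 : ∀ x, 0 ≤ χ x)
    (h1 : ∀ x, χ x ≤ 1) : HasWavePackets μ e i₀ i₁ K χ 1 (∫ x, χ x * χ x ∂μ) 0 0 := by
  intro δ hδ
  have hz : ∀ v : E, dirDeriv v (fun _ : E => (0 : ℝ)) = fun _ => 0 := fun v => by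
    funext x; simp [dirDeriv]
  refine ⟨χ, fun _ => 0, χ, fun _ => 0, fun _ => 0, hχ, IsTest.zero K, hχ, IsTest.zero K,
    IsTest.zero K, h0, fun x => ?_, ?_, ?_, ?_, ?_, ?_, ?_, ?_, ?_, ?_⟩
  · nlinarith [h0 x, h1 x]
  all_goals simp [hz, hδ]

/-- Each step rotates `(A, B)` slightly, in the direction given by `τ`. Using `τ = 1` and then `τ =
-1` returns `B` to `0`, so `A` does not decrease, whereas the gain `c / 2 * A` in `T` is independent
of `τ` and accumulates. -/
theorem HasWavePackets.double_step [Finite ι] [DecidableEq ι] (hK : IsCompact K) (h01 : i₀ ≠ i₁)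
    (hp : ∀ i j, p j (e i) = if i = j then 1 else 0) (c : ℝ) {r A T : ℝ}
    (h : HasWavePackets μ e i₀ i₁ K χ r A 0 T) :
    HasWavePackets μ e i₀ i₁ K χ (r * (1 + c ^ 2) ^ 2) ((1 + c ^ 2 / 4) * A) 0 (T + c * A) := by
  have step : ∀ {τ : ℝ} {r A B T : ℝ}, τ ^ 2 = 1 → HasWavePackets μ e i₀ i₁ K χ r A B T →
      HasWavePackets μ e i₀ i₁ K χ (r * (1 + c ^ 2)) (A - c * τ / 2 * B) (B + c * τ / 2 * A)
        (T + c / 2 * A) := by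
    intro τ r A B T hτ h δ hδ
    obtain ⟨P, F, G, g, w, hP⟩ := h (δ / (2 * (1 + |c|))) (by positivity)
    exact hP.step hK hτ (a := p i₀ + τ • p i₁) (by simp [hp, h01]) (by simp [hp, h01.symm])
      (fun i hi₀ hi₁ => by simp [hp, hi₀, hi₁]) hδ
  have := step (τ := -1) (by norm_num) (step (τ := 1) (by norm_num) h)
  convert this using 1 <;> ring

theorem hasWavePackets_iterate [Finite ι] [DecidableEq ι] (hK : IsCompact K) (h01 : i₀ ≠ i₁)
    (hp : ∀ i j, p j (e i) = if i = j then 1 else 0) (hχ : IsTest K χ) (h0 : ∀ x, 0 ≤ χ x)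
    (h1 : ∀ x, χ x ≤ 1) {c : ℝ} (hc : 0 ≤ c) (n : ℕ) :
    ∃ A T, ∫ x, χ x * χ x ∂μ ≤ A ∧ n * (c * ∫ x, χ x * χ x ∂μ) ≤ T ∧
      HasWavePackets μ e i₀ i₁ K χ (((1 + c ^ 2) ^ n) ^ 2) A 0 T := by
  have hA : 0 ≤ ∫ x, χ x * χ x ∂μ := integral_nonneg fun x => mul_self_nonneg _
  induction n with
  | zero => exact ⟨_, 0, le_rfl, by simp, by
      simpa using hasWavePackets_initial hχ h0 h1⟩
  | succ n ih =>
    obtain ⟨A, T, hAA, hT, h⟩ := ih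
    refine ⟨_, _, ?_, ?_, (by
      have := h.double_step hK h01 hp c
      rwa [← mul_pow, ← pow_succ] at this)⟩
    · nlinarith [sq_nonneg c]
    · push_cast
      nlinarith [mul_le_mul_of_nonneg_left hAA hc]

theorem IsTest.integral_abs_le {f b : E → ℝ} (hf : IsTest K f) (hK : IsCompact K)
    (hb : IsTest K b) {δ : ℝ} (h : ∀ x, |f x| ≤ b x + δ) :
    ∫ x, |f x| ∂μ ≤ ∫ x, b x ∂μ + δ * μ.real K := by
  have hz : ∀ x, x ∉ K → |f x| = 0 := fun x hx => by rw [hf.eq_zero x hx, abs_zero]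
  have hib : IntegrableOn b K μ := (hb.integrable hK).integrableOn
  have hic : IntegrableOn (fun _ : E => δ) K μ :=
    integrableOn_const hK.measure_lt_top.ne
  rw [← setIntegral_eq_integral_of_forall_compl_eq_zero hz,
    ← setIntegral_eq_integral_of_forall_compl_eq_zero hb.eq_zero]
  calc ∫ x in K, |f x| ∂μ ≤ ∫ x in K, (b x + δ) ∂μ :=
        setIntegral_mono (hf.integrable hK).abs.integrableOn (hib.add hic) h
    _ = ∫ x in K, b x ∂μ + δ * μ.real K := by
        rw [integral_add hib hic, setIntegral_const, smul_eq_mul, mul_comm]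

/-- Failure of the `L¹` estimate of `∂₀∂₁ g` by pure second derivatives, tested against derivatives
of functions `w` with bounded `∂ᵢ w` for `i ≠ 1`. -/
theorem exists_large_pairing [Finite ι] [DecidableEq ι] (hK : IsCompact K) (h01 : i₀ ≠ i₁)
    (hp : ∀ i j, p j (e i) = if i = j then 1 else 0) (hχ : IsTest K χ) (h0 : ∀ x, 0 ≤ χ x)
    (h1 : ∀ x, χ x ≤ 1) (hpos : 0 < ∫ x, χ x * χ x ∂μ) (M : ℝ) :
    ∃ g w : E → ℝ, IsTest K g ∧ IsTest K w ∧ (∀ i, i ≠ i₁ → ∀ x, |dirDeriv (e i) w x| ≤ 4) ∧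
      M ≤ ∫ x, dirDeriv (e i₀) w x * dirDeriv (e i₀) (dirDeriv (e i₁) g) x ∂μ ∧
      ∫ x, |dirDeriv (e i₁) (dirDeriv (e i₁) g) x| ∂μ ≤ 1 + 3 * μ.real K ∧
      ∀ i, i ≠ i₁ → ∫ x, |dirDeriv (e i₀) (dirDeriv (e i) g) x| ∂μ ≤ 1 + 3 * μ.real K := by
  set A₀ := ∫ x, χ x * χ x ∂μ with hA₀
  -- With `c = n^(-1/2)` the gain is at least `√n * A₀ ≥ M + 1`; the extra `1` absorbs the error `δ
  -- = 1` used below.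
  obtain ⟨n, hn⟩ := exists_nat_ge (((M + 1) / A₀) ^ 2 + 1)
  have hn1 : (1 : ℝ) ≤ n := le_trans (by nlinarith [sq_nonneg ((M + 1) / A₀)]) hn
  have hn0 : (0 : ℝ) < n := by linarith
  have hs0 : 0 < Real.sqrt n := Real.sqrt_pos.2 hn0
  obtain ⟨A, T, -, hT, h⟩ := hasWavePackets_iterate (μ := μ) hK h01 hp hχ h0 h1
    (inv_nonneg.2 hs0.le) n
  have hT' : M + 1 ≤ T := by
    have e1 : (n : ℝ) * ((Real.sqrt n)⁻¹ * A₀) = Real.sqrt n * A₀ := by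
      conv_lhs => rw [← Real.mul_self_sqrt hn0.le]
      field_simp
      rw [Real.sqrt_sq hs0.le]
    rw [e1] at hT
    refine le_trans ?_ hT
    rw [← div_le_iff₀ hpos]
    exact Real.le_sqrt_of_sq_le (by linarith)
  -- Here `(1 + 1 / n) ^ n ≤ e ≤ 3`, so `|F| ≤ 3`; with the error `1` this yields the bound `4` on
  -- `∂₀w`.
  have hr : ((1 + (Real.sqrt n)⁻¹ ^ 2) ^ n) ^ 2 ≤ (3 : ℝ) ^ 2 := by
    rw [inv_pow, Real.sq_sqrt hn0.le]
    have : (1 + (n : ℝ)⁻¹) ^ n ≤ 3 := by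
      calc (1 + (n : ℝ)⁻¹) ^ n ≤ (Real.exp ((n : ℝ)⁻¹)) ^ n := by
            gcongr
            rw [add_comm]
            exact Real.add_one_le_exp _
        _ = Real.exp 1 := by
            rw [← Real.exp_nat_mul, mul_inv_cancel₀ hn0.ne']
        _ ≤ 3 := by linarith [Real.exp_one_lt_d9]
    gcongr
  obtain ⟨P, F, G, g, w, hw⟩ := h 1 one_pos
  have hK0 : 0 ≤ μ.real K := measureReal_nonneg
  have hχK : ∫ x, χ x ∂μ ≤ μ.real K := by
    simpa using (le_abs_self _).trans (abs_integral_le_of_vanishing (μ := μ) hK hχ.eq_zero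
      (C := 1) fun x => abs_le.2 ⟨by linarith [h0 x], h1 x⟩)
  have hPχ := (abs_lt.1 hw.mass).2
  -- The bound is `∫P + ∫χ + μ(K)`, with `∫P ≤ ∫χ + 1` and `∫χ ≤ μ(K)`.
  have hpure : ∀ {f : E → ℝ}, IsTest K f → (∀ x, |f x - (P x - χ x)| < 1) →
      ∫ x, |f x| ∂μ ≤ 1 + 3 * μ.real K := by
    intro f hf hfx
    have := hf.integral_abs_le (μ := μ) hK (hw.test_P.add hχ) (δ := 1) fun x => by
      have h1 := abs_lt.1 (hfx x)
      have h2 := hw.nonneg x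
      have h3 := h0 x
      rw [abs_le]
      constructor <;> linarith
    rw [integral_add (hw.test_P.integrable hK) (hχ.integrable hK)] at this
    linarith
  have hdd : ∀ i j, IsTest K (dirDeriv (e i) (dirDeriv (e j) g)) := fun i j =>
    (hw.test_g.along hK.isClosed _).along hK.isClosed _
  refine ⟨g, w, hw.test_g, hw.test_w, fun i hi x => ?_, ?_, hpure (hdd _ _) hw.pure₁, fun i hi => ?_⟩
  · by_cases hi₀ : i = i₀
    · have h1 := abs_lt.1 (hw.deriv_w x)
      have h2 : |F x| ≤ 3 := abs_le_of_sq_le_sq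
        (by nlinarith [(hw.sq_le x).trans hr, sq_nonneg (G x)]) (by norm_num)
      rw [abs_le] at h2
      rw [hi₀, abs_le]
      constructor <;> linarith
    · linarith [hw.deriv_w_other i hi₀ hi x]
  · have := (abs_lt.1 hw.pairing).1
    linarith
  · by_cases hi₀ : i = i₀
    · rw [hi₀]; exact hpure (hdd _ _) hw.pure₀
    · have := (hdd i₀ i).integral_abs_le (μ := μ) hK (IsTest.zero K) (δ := 1) fun x => by
        linarith [hw.mixed i hi₀ hi x]
      simp only [integral_zero] at this
      linarith

end L1Estimate

/-! ### Exterior derivatives of forms with a single coefficient. -/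

section Forms

theorem finiteDimensional_alternating (d k : ℕ) :
    FiniteDimensional ℝ (EuclideanSpace ℝ (Fin d) [⋀^Fin k]→L[ℝ] ℝ) :=
  FiniteDimensional.of_injective
    (V₂ := MultilinearMap ℝ (fun _ : Fin k => EuclideanSpace ℝ (Fin d)) ℝ)
    ({ toFun := fun f => f.toMultilinearMap
       map_add' := fun _ _ => rfl
       map_smul' := fun _ _ => rfl } :
      (EuclideanSpace ℝ (Fin d) [⋀^Fin k]→L[ℝ] ℝ) →ₗ[ℝ] _)
    (fun _ _ h => ContinuousAlternatingMap.ext fun v => congrArg (fun u => u v) h)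

/-- The coordinate vectors of `ℝ^d`. -/
noncomputable abbrev stdVec {d : ℕ} (i : Fin d) : EuclideanSpace ℝ (Fin d) :=
  EuclideanSpace.single i 1

/-- The coordinate functions of `ℝ^d`. -/
noncomputable abbrev stdCoord {d : ℕ} (i : Fin d) : EuclideanSpace ℝ (Fin d) →L[ℝ] ℝ :=
  EuclideanSpace.proj i

/-- The covector `dx_{s 0} ∧ … ∧ dx_{s (k-1)}`. -/
noncomputable def coordForm {d k : ℕ} (s : Fin k → Fin d) :
    EuclideanSpace ℝ (Fin d) [⋀^Fin k]→L[ℝ] ℝ :=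
  { (Matrix.detRowAlternating (n := Fin k) (R := ℝ)).compLinearMap
      (LinearMap.pi fun r => (stdCoord (s r) : EuclideanSpace ℝ (Fin d) →ₗ[ℝ] ℝ)) with
    cont := by
      refine Continuous.matrix_det (A := fun v : Fin k → EuclideanSpace ℝ (Fin d) =>
        Matrix.of fun j r => v j (s r)) ?_
      fun_prop }

theorem coordForm_apply {d k : ℕ} (s : Fin k → Fin d) (v : Fin k → EuclideanSpace ℝ (Fin d)) :
    coordForm s v = (Matrix.of fun j r => v j (s r)).det := rfl

variable {d k : ℕ}

/-- The covector `dx_i ∧ dx_{s 0} ∧ … ∧ dx_{s (k-1)}`. -/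
noncomputable def wedgeCoord (i : Fin d) (s : Fin k → Fin d) :
    EuclideanSpace ℝ (Fin d) [⋀^Fin (k + 1)]→L[ℝ] ℝ :=
  .alternatizeUncurryFin ((stdCoord i).smulRight (coordForm s))

/-- Laplace expansion identifies the value with a determinant having a repeated row. This is what
permits one derivative of `w` to be unbounded. -/
theorem wedgeCoord_eq_zero (s : Fin k → Fin d) (r : Fin k) : wedgeCoord (s r) s = 0 := by
  ext v
  set M : Matrix (Fin (k + 1)) (Fin (k + 1)) ℝ :=
    Matrix.of fun t j => v j (Fin.cases (s r) s t) with hM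
  have h1 : M.det = 0 := Matrix.det_zero_of_row_eq (Fin.succ_ne_zero r).symm (by
    funext j; simp [hM])
  have h2 : wedgeCoord (s r) s v = M.det := by
    rw [wedgeCoord, ContinuousAlternatingMap.alternatizeUncurryFin_apply,
      Matrix.det_succ_row_zero]
    refine Finset.sum_congr rfl fun j _ => ?_
    have h3 : coordForm s (j.removeNth v) = (M.submatrix Fin.succ j.succAbove).det := by
      rw [coordForm_apply, ← Matrix.det_transpose]
      congr 1
    have h4 : M 0 j = v j (s r) := rfl
    rw [← h3, h4]
    simp [mul_assoc]
  rw [h2, h1]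
  rfl

theorem fderiv_smul_coordForm {w : EuclideanSpace ℝ (Fin d) → ℝ} (hw : Differentiable ℝ w)
    (s : Fin k → Fin d) (x : EuclideanSpace ℝ (Fin d)) :
    fderiv ℝ (fun x => w x • coordForm s) x = (fderiv ℝ w x).smulRight (coordForm s) := by
  exact (HasFDerivAt.smul_const (F := EuclideanSpace ℝ (Fin d) [⋀^Fin k]→L[ℝ] ℝ)
    (hw x).hasFDerivAt (coordForm s)).fderiv

theorem extDeriv_smul_coordForm {w : EuclideanSpace ℝ (Fin d) → ℝ} (hw : Differentiable ℝ w)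
    (s : Fin k → Fin d) (x : EuclideanSpace ℝ (Fin d)) :
    extDeriv (fun x => w x • coordForm s) x =
      ∑ i, dirDeriv (stdVec i) w x • wedgeCoord i s := by
  have h1 : fderiv ℝ (fun x => w x • coordForm s) x = (fderiv ℝ w x).smulRight (coordForm s) :=
    fderiv_smul_coordForm hw _ x
  have h2 : (fderiv ℝ w x).smulRight (coordForm s) =
      ∑ i, dirDeriv (stdVec i) w x • (stdCoord i).smulRight (coordForm s) := by
    ext y v
    have hy : y = ∑ i, y i • stdVec i := by
      ext j
      simp [Finset.sum_apply, Pi.single_apply]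
    have : fderiv ℝ w x y = ∑ i, y i * dirDeriv (stdVec i) w x := by
      conv_lhs => rw [hy]
      simp [dirDeriv]
    simp [this, Finset.sum_mul, ContinuousAlternatingMap.sum_apply]
    refine Finset.sum_congr rfl fun i _ => by ring
  rw [extDeriv, h1, h2]
  exact map_sum (ContinuousAlternatingMap.alternatizeUncurryFinCLM ℝ _ ℝ) _ _ |>.trans (by
    refine Finset.sum_congr rfl fun i _ => ?_
    exact map_smul (ContinuousAlternatingMap.alternatizeUncurryFinCLM ℝ _ ℝ) _ _)

theorem norm_extDeriv_smul_coordForm_le {w : EuclideanSpace ℝ (Fin d) → ℝ}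
    (hw : Differentiable ℝ w) (s : Fin k → Fin d) (r : Fin k) {C : ℝ}
    (hC : ∀ i, i ≠ s r → ∀ x, |dirDeriv (stdVec i) w x| ≤ C) (x : EuclideanSpace ℝ (Fin d)) :
    ‖extDeriv (fun x => w x • coordForm s) x‖ ≤ ∑ i, C * ‖wedgeCoord i s‖ := by
  rw [extDeriv_smul_coordForm hw]
  refine (norm_sum_le _ _).trans (Finset.sum_le_sum fun i _ => ?_)
  rw [norm_smul, Real.norm_eq_abs]
  by_cases hi : i = s r
  · rw [hi, wedgeCoord_eq_zero]; simp
  · exact mul_le_mul_of_nonneg_right (hC i hi x) (norm_nonneg _)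

theorem extDeriv_smul_coordForm_apply {w : EuclideanSpace ℝ (Fin d) → ℝ}
    (hw : Differentiable ℝ w) (hk : 0 < k) (t : Fin (k + 1) → Fin d) (ht : Function.Injective t)
    (x : EuclideanSpace ℝ (Fin d)) :
    extDeriv (fun x => w x • coordForm (fun r => t r.succ)) x (fun j => stdVec (t j)) =
      dirDeriv (stdVec (t 0)) w x := by
  have h1 : fderiv ℝ (fun x => w x • coordForm (fun r => t r.succ)) x =
      (fderiv ℝ w x).smulRight (coordForm (fun r => t r.succ)) :=
    fderiv_smul_coordForm hw _ x
  rw [extDeriv, h1, ContinuousAlternatingMap.alternatizeUncurryFin_apply, Fin.sum_univ_succ]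
  have h2 : coordForm (fun r => t r.succ)
      (Fin.removeNth 0 fun j => (stdVec (t j) : EuclideanSpace ℝ (Fin d))) = 1 := by
    rw [coordForm_apply, ← Matrix.det_one (n := Fin k)]
    congr 1
    ext j r
    simp [Fin.removeNth, Matrix.one_apply, ht.eq_iff, eq_comm]
  -- Removing a later vector leaves `stdVec (t 0)` in slot `0`, where every `dx_{t (r+1)}` vanishes;
  -- `0 < k` ensures that this slot exists.
  have h3 : ∀ j : Fin k, coordForm (fun r => t r.succ)
      (Fin.removeNth j.succ fun j => (stdVec (t j) : EuclideanSpace ℝ (Fin d))) = 0 := by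
    intro j
    rw [coordForm_apply]
    refine Matrix.det_eq_zero_of_row_eq_zero ⟨0, hk⟩ fun r => ?_
    have h0 : j.succ.succAbove ⟨0, hk⟩ = 0 := by
      rw [Fin.succAbove_of_castSucc_lt _ _ (by simp [Fin.lt_def])]
      rfl
    simp [Fin.removeNth, h0, ht.eq_iff]
  simp only [ContinuousLinearMap.smulRight_apply, ContinuousAlternatingMap.smul_apply, h2, h3]
  simp [dirDeriv]

/-- A smooth compactly supported closed form is distributionally closed. -/
theorem integral_wedge_eq_zero {m : ℕ} {K : Set (EuclideanSpace ℝ (Fin d))} (hK : IsCompact K)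
    {θ : DiffForm d m} (hθ : ContDiff ℝ (⊤ : ℕ∞) θ) (hz : ∀ x, x ∉ K → θ x = 0)
    (hd : ∀ x, extDeriv θ x = 0) {φ : EuclideanSpace ℝ (Fin d) → ℝ}
    (hφ : ContDiff ℝ (⊤ : ℕ∞) φ) (v : Fin (m + 1) → EuclideanSpace ℝ (Fin d)) :
    ∫ x, ∑ i : Fin (m + 1),
      (-1 : ℝ) ^ (i : ℕ) * (fderiv ℝ φ x (v i) * θ x (i.removeNth v)) = 0 := by
  have ht : ∀ u : Fin m → EuclideanSpace ℝ (Fin d), IsTest K fun x => θ x u := fun u =>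
    ⟨(ContinuousAlternatingMap.apply ℝ (EuclideanSpace ℝ (Fin d)) ℝ u).contDiff.comp hθ,
      fun x hx => by rw [hz x hx]; rfl⟩
  -- Leibniz rule: `dφ ∧ θ = d(φθ)` because `dθ = 0`, and derivatives of compactly supported
  -- functions integrate to zero.
  have key : ∀ x, ∑ i : Fin (m + 1),
      (-1 : ℝ) ^ (i : ℕ) * (fderiv ℝ φ x (v i) * θ x (i.removeNth v)) =
      ∑ i : Fin (m + 1), (-1 : ℝ) ^ (i : ℕ) *
        dirDeriv (v i) (fun x => θ x (i.removeNth v) * φ x) x := by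
    intro x
    have h0 : ∑ i : Fin (m + 1), (-1 : ℝ) ^ (i : ℕ) *
        dirDeriv (v i) (fun x => θ x (i.removeNth v)) x = 0 := by
      have := extDeriv_apply (hθ.differentiable (by simp) x) v
      rw [hd] at this
      simpa [dirDeriv] using this.symm
    have h1 : ∀ i : Fin (m + 1), (-1 : ℝ) ^ (i : ℕ) *
        dirDeriv (v i) (fun x => θ x (i.removeNth v) * φ x) x =
        (-1 : ℝ) ^ (i : ℕ) * (fderiv ℝ φ x (v i) * θ x (i.removeNth v)) +
        ((-1 : ℝ) ^ (i : ℕ) * dirDeriv (v i) (fun x => θ x (i.removeNth v)) x) * φ x := by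
      intro i
      rw [dirDeriv_mul (ht _).differentiable (hφ.differentiable (by simp))]
      simp only [dirDeriv]
      ring
    simp_rw [h1]
    rw [Finset.sum_add_distrib, ← Finset.sum_mul, h0, zero_mul, add_zero]
  simp_rw [key]
  have htt : ∀ i : Fin (m + 1), IsTest K fun x => θ x (i.removeNth v) * φ x := fun i =>
    (ht _).mul_contDiff hφ
  rw [integral_finsetSum _ fun i _ => (((htt i).along hK.isClosed _).const_mul _).integrable hK]
  refine Finset.sum_eq_zero fun i _ => ?_
  rw [integral_const_mul, (htt i).integral_dirDeriv hK, mul_zero]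

end Forms

/-! ### Sums of forms with disjoint supports. -/

section DisjointSums

variable {d m : ℕ} {K : ℕ → Set (EuclideanSpace ℝ (Fin d))} {θ : ℕ → DiffForm d m}

theorem hasSum_of_mem_of_disjoint (hdisj : Pairwise (Function.onFun Disjoint K))
    (hz : ∀ n x, x ∉ K n → θ n x = 0) {n : ℕ} {x : EuclideanSpace ℝ (Fin d)} (hx : x ∈ K n) :
    HasSum (fun n => θ n x) (θ n x) :=
  hasSum_single n fun _ hj => hz _ _ fun hx' => (hdisj hj).le_bot ⟨hx', hx⟩

theorem hasSum_tsum_of_disjoint (hdisj : Pairwise (Function.onFun Disjoint K))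
    (hz : ∀ n x, x ∉ K n → θ n x = 0) (x : EuclideanSpace ℝ (Fin d)) :
    HasSum (fun n => θ n x) (∑' n, θ n x) := by
  by_cases hx : ∃ n, x ∈ K n
  · obtain ⟨n, hn⟩ := hx
    exact (hasSum_of_mem_of_disjoint hdisj hz hn).summable.hasSum
  · push Not at hx
    simp [fun n => hz n x (hx n), hasSum_zero]

theorem memLp_tsum_of_disjoint (hdisj : Pairwise (Function.onFun Disjoint K))
    (hz : ∀ n x, x ∉ K n → θ n x = 0) (hc : ∀ n, Continuous (θ n)) {C : ℝ}
    (hC : ∀ n x, ‖θ n x‖ ≤ C) : MemLp (fun x => ∑' n, θ n x) ∞ volume := by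
  have hs : StronglyMeasurable fun x => ∑' n, θ n x :=
    stronglyMeasurable_of_tendsto atTop (f := fun N x => ∑ n ∈ Finset.range N, θ n x)
      (fun N => (continuous_finsetSum _ fun n _ => hc n).stronglyMeasurable)
      (tendsto_pi_nhds.2 fun x => (hasSum_tsum_of_disjoint hdisj hz x).tendsto_sum_nat)
  refine memLp_top_of_bound hs.aestronglyMeasurable C (ae_of_all _ fun x => ?_)
  by_cases hx : ∃ n, x ∈ K n
  · obtain ⟨n, hn⟩ := hx
    rw [(hasSum_of_mem_of_disjoint hdisj hz hn).tsum_eq]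
    exact hC n x
  · push Not at hx
    simpa [fun n => hz n x (hx n)] using (norm_nonneg _).trans (hC 0 x)

/-- A uniformly bounded sum of smooth closed forms with disjoint compact supports is
distributionally closed. -/
theorem distributionallyClosed_tsum (hK : ∀ n, IsCompact (K n))
    (hdisj : Pairwise (Function.onFun Disjoint K)) (hz : ∀ n x, x ∉ K n → θ n x = 0)
    (hθ : ∀ n, ContDiff ℝ (⊤ : ℕ∞) (θ n)) (hd : ∀ n x, extDeriv (θ n) x = 0) {C : ℝ}
    (hC : ∀ n x, ‖θ n x‖ ≤ C) : DistributionallyClosed fun x => ∑' n, θ n x := by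
  have hmem := memLp_tsum_of_disjoint hdisj hz (fun n => (hθ n).continuous) hC
  have hloc : LocallyIntegrable (fun x => ∑' n, θ n x) volume := hmem.locallyIntegrable le_top
  refine ⟨hloc, fun φ hφ hφc v => ?_⟩
  set η : DiffForm d m := fun x => ∑' n, θ n x with hη
  have hint : Integrable (fun x => ∑ i : Fin (m + 1),
      (-1 : ℝ) ^ (i : ℕ) * (fderiv ℝ φ x (v i) * η x (i.removeNth v))) volume := by
    refine integrable_finsetSum _ fun i _ => Integrable.const_mul ?_ _
    have h1 : LocallyIntegrable (fun x => η x (i.removeNth v)) volume := by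
      intro x
      obtain ⟨s, hs, hi⟩ := hloc x
      exact ⟨s, hs, (ContinuousAlternatingMap.apply ℝ (EuclideanSpace ℝ (Fin d)) ℝ
        (i.removeNth v)).integrable_comp hi⟩
    have h2 : Continuous fun x => fderiv ℝ φ x (v i) :=
      (hφ.continuous_fderiv (by simp)).clm_apply continuous_const
    have h3 : HasCompactSupport fun x => fderiv ℝ φ x (v i) := hφc.fderiv_apply ℝ (v i)
    simpa using h1.integrable_smul_left_of_hasCompactSupport h2 h3
  have hon : ∀ n, ∀ x ∈ K n, η x = θ n x := fun n x hx =>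
    (hasSum_of_mem_of_disjoint hdisj hz hx).tsum_eq
  have hoff : ∀ x, x ∉ ⋃ n, K n → η x = 0 := fun x hx => by
    simp only [Set.mem_iUnion, not_exists] at hx
    simp [hη, fun n => hz n x (hx n)]
  -- Integrability of the whole pairing permits splitting the integral over the disjoint supports,
  -- each contributing zero.
  rw [← setIntegral_eq_integral_of_forall_compl_eq_zero (s := ⋃ n, K n)
    (fun x hx => by simp [hoff x hx]),
    integral_iUnion (fun n => (hK n).measurableSet) hdisj hint.integrableOn]
  refine (tsum_congr fun n => ?_).trans tsum_zero
  rw [setIntegral_congr_fun (hK n).measurableSet (g := fun x => ∑ i : Fin (m + 1),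
      (-1 : ℝ) ^ (i : ℕ) * (fderiv ℝ φ x (v i) * θ n x (i.removeNth v)))
    (fun x hx => by simp only [hon n x hx]),
    setIntegral_eq_integral_of_forall_compl_eq_zero (fun x hx => by simp [hz n x hx])]
  exact integral_wedge_eq_zero (hK n) (hθ n) (hz n) (hd n) hφ v

end DisjointSums

/-- An infinite Hausdorff space contains infinitely many disjoint nonempty open sets; a closed ball
in each carries a bump. -/
theorem exists_seq_disjoint_bumps {E : Type*} [NormedAddCommGroup E] [NormedSpace ℝ E]
    [MeasurableSpace E] [BorelSpace E] [FiniteDimensional ℝ E] [Nontrivial E] (μ : Measure E)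
    [μ.IsAddHaarMeasure] {V : Set E} (hV : IsOpen V) (hne : V.Nonempty) :
    ∃ (K : ℕ → Set E) (χ : ℕ → E → ℝ), Pairwise (Function.onFun Disjoint K) ∧ ∀ n,
      IsCompact (K n) ∧ K n ⊆ V ∧ IsTest (K n) (χ n) ∧ (∀ x, 0 ≤ χ n x) ∧ (∀ x, χ n x ≤ 1) ∧
        0 < ∫ x, χ n x * χ n x ∂μ := by
  obtain ⟨x₀, hx₀⟩ := hne
  have := Module.punctured_nhds_neBot ℝ E x₀
  have : Infinite V := (infinite_of_mem_nhds x₀ (hV.mem_nhds hx₀)).to_subtype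
  obtain ⟨U, hinf, hopen, hdisj⟩ := exists_seq_infinite_isOpen_pairwise_disjoint V
  have hball : ∀ n, ∃ (y : E) (r : ℝ), 0 < r ∧ Metric.closedBall y r ⊆ Subtype.val '' U n := by
    intro n
    obtain ⟨y, hy⟩ := (hinf n).nonempty
    obtain ⟨r, hr, h⟩ := Metric.nhds_basis_closedBall.mem_iff.1
      ((hV.isOpenMap_subtype_val _ (hopen n)).mem_nhds (Set.mem_image_of_mem _ hy))
    exact ⟨y, r, hr, h⟩
  choose y r hr hsub using hball
  let b : ∀ n, ContDiffBump (y n) := fun n => ⟨r n / 2, r n, half_pos (hr n), half_lt_self (hr n)⟩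
  refine ⟨fun n => Metric.closedBall (y n) (r n), fun n => b n, fun i j hij => ?_, fun n => ?_⟩
  · exact ((Set.disjoint_image_iff Subtype.val_injective).2 (hdisj hij)).mono (hsub i) (hsub j)
  · have ht : IsTest (Metric.closedBall (y n) (r n)) (b n) := by
      refine ⟨(b n).contDiff, fun x hx => (b n).zero_of_le_dist ?_⟩
      rw [Metric.mem_closedBall, not_le] at hx
      exact hx.le
    have hc : IsCompact (Metric.closedBall (y n) (r n)) := isCompact_closedBall _ _
    refine ⟨hc, (hsub n).trans (Subtype.coe_image_subset V (U n)), ht, fun x => (b n).nonneg,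
      fun x => (b n).le_one, ?_⟩
    refine Continuous.integral_pos_of_hasCompactSupport_nonneg_nonzero (x := y n)
      (ht.mul ht).continuous ((ht.mul ht).hasCompactSupport hc) (fun x => mul_self_nonneg _) ?_
    dsimp only
    rw [(b n).one_of_mem_closedBall (Metric.mem_closedBall_self (b n).rIn_pos.le)]
    norm_num

/-! ### Integration by parts against Lipschitz functions. -/

section LipschitzPairing

variable {E : Type*} [NormedAddCommGroup E] [NormedSpace ℝ E] [MeasurableSpace E]
  [BorelSpace E] [FiniteDimensional ℝ E] {μ : Measure E} [μ.IsAddHaarMeasure]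
  {K : Set E} {C : NNReal} {u f : E → ℝ}

theorem LipschitzWith.integral_lineDeriv_mul_isTest (hu : LipschitzWith C u) (hf : IsTest K f)
    (hK : IsCompact K) (v : E) :
    ∫ x, lineDeriv ℝ u x v * f x ∂μ = -∫ x, dirDeriv v f x * u x ∂μ := by
  obtain ⟨D, hD⟩ := ContDiff.lipschitzWith_of_hasCompactSupport (hf.hasCompactSupport hK)
    hf.contDiff (by simp)
  rw [hu.integral_lineDeriv_mul_eq hD (hf.hasCompactSupport hK), ← integral_neg]
  congr 1
  funext x
  rw [(hf.differentiable x).lineDeriv_eq_fderiv]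
  simp [dirDeriv]

/-- Moving the derivative off `u` puts both on `f`, where they commute; thus no second derivative of
`u` is needed. -/
theorem LipschitzWith.integral_lineDeriv_mul_comm (hu : LipschitzWith C u) (hf : IsTest K f)
    (hK : IsCompact K) (v w : E) :
    ∫ x, lineDeriv ℝ u x v * dirDeriv w f x ∂μ = ∫ x, lineDeriv ℝ u x w * dirDeriv v f x ∂μ := by
  rw [hu.integral_lineDeriv_mul_isTest (hf.along hK.isClosed w) hK,
    hu.integral_lineDeriv_mul_isTest (hf.along hK.isClosed v) hK, dirDeriv_comm hf.contDiff]

theorem LipschitzWith.integrable_lineDeriv_mul (hu : LipschitzWith C u) (hf : IsTest K f)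
    (hK : IsCompact K) (v : E) : Integrable (fun x => lineDeriv ℝ u x v * f x) μ :=
  (hf.integrable hK).bdd_mul (hu.memLp_lineDeriv (μ := μ) v).aestronglyMeasurable
    (ae_of_all _ fun _ => norm_lineDeriv_le_of_lipschitz ℝ hu)

theorem LipschitzWith.abs_integral_lineDeriv_mul_le (hu : LipschitzWith C u) (hf : IsTest K f)
    (hK : IsCompact K) {v : E} (hv : ‖v‖ = 1) :
    |∫ x, lineDeriv ℝ u x v * f x ∂μ| ≤ C * ∫ x, |f x| ∂μ := by
  rw [← integral_const_mul, ← Real.norm_eq_abs]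
  refine norm_integral_le_of_norm_le ((hf.integrable hK).abs.const_mul _)
    (ae_of_all _ fun x => ?_)
  rw [norm_mul]
  refine mul_le_mul_of_nonneg_right ?_ (abs_nonneg _)
  simpa [hv] using norm_lineDeriv_le_of_lipschitz ℝ hu (x₀ := x) (v := v)

end LipschitzPairing

/-! ### Duality bound for Lipschitz primitives. -/

variable {d k : ℕ}

/-- The coefficients of a Lipschitz form with respect to unit vectors extend to Lipschitz functions
on the whole space, and express the coefficient of its exterior derivative as a divergence. -/
theorem exists_lipschitz_coefficients {Q V : Set (EuclideanSpace ℝ (Fin d))} (hV : IsOpen V)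
    (hVQ : V ⊆ Q) {ω : DiffForm d k} {C : NNReal} (hω : LipschitzOnWith C ω Q)
    (b : Fin (k + 1) → EuclideanSpace ℝ (Fin d)) (hb : ∀ j, ‖b j‖ = 1) :
    ∃ u : Fin (k + 1) → EuclideanSpace ℝ (Fin d) → ℝ, (∀ j, LipschitzWith C (u j)) ∧
      ∀ᵐ x, x ∈ V → extDerivWithin ω Q x b = ∑ j, lineDeriv ℝ (u j) x (b j) := by
  have hcoef : ∀ j : Fin (k + 1),
      LipschitzOnWith C (fun x => (-1 : ℝ) ^ (j : ℕ) * ω x (j.removeNth b)) Q := by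
    intro j
    refine LipschitzOnWith.of_dist_le_mul fun x hx y hy => ?_
    rw [Real.dist_eq, ← mul_sub, abs_mul, abs_pow, abs_neg, abs_one, one_pow, one_mul]
    have h1 := (ω x - ω y).le_opNorm (j.removeNth b)
    have h2 : ∏ i, ‖j.removeNth b i‖ = 1 := Finset.prod_eq_one fun i _ => hb _
    rw [h2, mul_one, ← dist_eq_norm] at h1
    exact h1.trans (hω.dist_le_mul x hx y hy)
  choose u hu hue using fun j => (hcoef j).extend_real
  refine ⟨u, hu, ?_⟩
  have := finiteDimensional_alternating d k
  filter_upwards [hω.ae_differentiableWithinAt_of_mem (μ := volume)] with x hx hxV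
  have hQ : Q ∈ 𝓝 x := mem_of_superset (hV.mem_nhds hxV) hVQ
  have hdiff : DifferentiableAt ℝ ω x := (hx (hVQ hxV)).differentiableAt hQ
  rw [extDerivWithin, fderivWithin_of_mem_nhds hQ,
    ContinuousAlternatingMap.alternatizeUncurryFin_apply]
  refine Finset.sum_congr rfl fun j _ => ?_
  have h1 : u j =ᶠ[𝓝 x] fun x => (-1 : ℝ) ^ (j : ℕ) * ω x (j.removeNth b) := by
    filter_upwards [hQ] with y hy using (hue j hy).symm
  have h2 : HasFDerivAt (fun x => (-1 : ℝ) ^ (j : ℕ) * ω x (j.removeNth b))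
      ((-1 : ℝ) ^ (j : ℕ) • (ContinuousAlternatingMap.apply ℝ (EuclideanSpace ℝ (Fin d)) ℝ
        (j.removeNth b) ∘L fderiv ℝ ω x)) x :=
    ((ContinuousAlternatingMap.apply ℝ (EuclideanSpace ℝ (Fin d)) ℝ
      (j.removeNth b)).hasFDerivAt.comp x hdiff.hasFDerivAt).const_mul _
  rw [((h2.congr_of_eventuallyEq h1).hasLineDerivAt (b j)).lineDeriv]
  simp

/-- A Lipschitz form pairs with `∂₀∂₁ g` like second derivatives of `g` that exclude the mixed
derivative `∂₀∂₁`. -/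
theorem abs_integral_extDerivWithin_mul_le {Q V K : Set (EuclideanSpace ℝ (Fin d))}
    (hV : IsOpen V) (hVQ : V ⊆ Q) (hK : IsCompact K) (hKV : K ⊆ V) {ω : DiffForm d k} {C : NNReal}
    (hω : LipschitzOnWith C ω Q) (b : Fin (k + 1) → EuclideanSpace ℝ (Fin d))
    (hb : ∀ j, ‖b j‖ = 1) (j₀ j₁ : Fin (k + 1)) {h g : EuclideanSpace ℝ (Fin d) → ℝ}
    (hh : ∀ᵐ x, x ∈ Q → extDerivWithin ω Q x b = h x) (hg : IsTest K g) {L : ℝ}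
    (h11 : ∫ x, |dirDeriv (b j₁) (dirDeriv (b j₁) g) x| ≤ L)
    (h0 : ∀ j, j ≠ j₁ → ∫ x, |dirDeriv (b j₀) (dirDeriv (b j) g) x| ≤ L) :
    |∫ x, h x * dirDeriv (b j₀) (dirDeriv (b j₁) g) x| ≤ (k + 1) * (C * L) := by
  obtain ⟨u, hu, hdiv⟩ := exists_lipschitz_coefficients hV hVQ hω b hb
  have t : ∀ v, IsTest K (dirDeriv v g) := fun v => hg.along hK.isClosed v
  have tt : ∀ v w, IsTest K (dirDeriv v (dirDeriv w g)) := fun v w => (t w).along hK.isClosed v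
  have heq : ∫ x, h x * dirDeriv (b j₀) (dirDeriv (b j₁) g) x =
      ∫ x, ∑ j, lineDeriv ℝ (u j) x (b j) * dirDeriv (b j₀) (dirDeriv (b j₁) g) x := by
    refine integral_congr_ae ?_
    filter_upwards [hdiv, hh] with x hx hhx
    rw [← Finset.sum_mul]
    by_cases hxK : x ∈ K
    · rw [← hx (hKV hxK), hhx (hVQ (hKV hxK))]
    · simp only [(tt _ _).eq_zero x hxK, mul_zero]
  rw [heq, integral_finsetSum _ fun j _ => (hu j).integrable_lineDeriv_mul (tt _ _) hK _]
  refine (Finset.abs_sum_le_sum_abs _ _).trans ?_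
  have hterm : ∀ j, |∫ x, lineDeriv ℝ (u j) x (b j) * dirDeriv (b j₀) (dirDeriv (b j₁) g) x| ≤
      C * L := by
    intro j
    by_cases hj : j = j₁
    · rw [hj, (hu j₁).integral_lineDeriv_mul_comm (t _) hK]
      exact ((hu j₁).abs_integral_lineDeriv_mul_le (tt _ _) hK (hb _)).trans
        (mul_le_mul_of_nonneg_left h11 C.coe_nonneg)
    · rw [dirDeriv_comm hg.contDiff, (hu j).integral_lineDeriv_mul_comm (t _) hK,
        dirDeriv_comm hg.contDiff]
      exact ((hu j).abs_integral_lineDeriv_mul_le (tt _ _) hK (hb _)).trans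
        (mul_le_mul_of_nonneg_left (h0 j hj) C.coe_nonneg)
  calc _ ≤ ∑ _j : Fin (k + 1), (C : ℝ) * L := Finset.sum_le_sum fun j _ => hterm j
    _ = (k + 1) * (C * L) := by simp

/-! ### Assembly of the counterexample. -/

theorem theorem6 (d k : ℕ) (hk : 1 ≤ k) (hkd : k + 1 ≤ d) :
    ∃ η : DiffForm d (k + 1),
      MemLp η ∞ volume ∧
      DistributionallyClosed η ∧
      (∀ x, x ∉ unitCube d → η x = 0) ∧
      ¬ ∃ ω : DiffForm d k, IsLipschitzSolutionOn (unitCube d) η ω := by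
  set t : Fin (k + 1) → Fin d := Fin.castLE hkd with ht
  have htinj : Function.Injective t := Fin.castLE_injective hkd
  -- The exceptional direction `t j₁` is the first index of `s` below, so its derivative of `w n`
  -- does not enter `θ n`; this index exists because `1 ≤ k`.
  set j₁ : Fin (k + 1) := Fin.succ ⟨0, hk⟩ with hj₁
  have h01 : t 0 ≠ t j₁ := fun h => (Fin.succ_ne_zero _).symm (htinj h)
  have : Nontrivial (EuclideanSpace ℝ (Fin d)) := by
    have : Nonempty (Fin d) := ⟨t 0⟩
    infer_instance
  set V : Set (EuclideanSpace ℝ (Fin d)) :=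
    Metric.ball (WithLp.toLp 2 fun _ => (1 / 2 : ℝ)) (1 / 2) with hVdef
  have hVo : IsOpen V := Metric.isOpen_ball
  have hVQ : V ⊆ unitCube d := by
    intro x hx i
    have h1 := (PiLp.norm_apply_le (x - WithLp.toLp 2 fun _ => (1 / 2 : ℝ)) i).trans_lt
      (mem_ball_iff_norm.1 hx)
    rw [Real.norm_eq_abs, abs_lt] at h1
    simp at h1
    constructor <;> linarith
  obtain ⟨K, χ, hdisj, hKχ⟩ := exists_seq_disjoint_bumps volume hVo
    ⟨_, Metric.mem_ball_self (by norm_num)⟩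
  choose hK hKV hχ hχ0 hχ1 hχpos using hKχ
  have hp : ∀ i j : Fin d, stdCoord j (stdVec i) = if i = j then (1 : ℝ) else 0 := fun i j => by
    simp [eq_comm]
  choose g w hg hw hwb hpair h11 h0 using fun n : ℕ =>
    exists_large_pairing (μ := volume) (hK n) h01 hp (hχ n) (hχ0 n) (hχ1 n) (hχpos n) n
  set s : Fin k → Fin d := fun r => t r.succ with hs
  set θ : ℕ → DiffForm d (k + 1) := fun n => extDeriv fun x => w n x • coordForm s with hθ
  have hsm : ∀ n, ContDiff ℝ (⊤ : ℕ∞) fun x => w n x • coordForm s := fun n =>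
    (hw n).contDiff.smul contDiff_const
  have hθz : ∀ n x, x ∉ K n → θ n x = 0 := by
    intro n x hx
    rw [show θ n x = _ from extDeriv_smul_coordForm (hw n).differentiable s x]
    exact Finset.sum_eq_zero fun i _ => by
      rw [((hw n).along (hK n).isClosed _).eq_zero x hx, zero_smul]
  have hθs : ∀ n, ContDiff ℝ (⊤ : ℕ∞) (θ n) := fun n =>
    ContDiff.comp (g := ContinuousAlternatingMap.alternatizeUncurryFinCLM ℝ
      (EuclideanSpace ℝ (Fin d)) ℝ (n := k)) (ContinuousLinearMap.contDiff _)
      ((hsm n).fderiv_right (m := (⊤ : ℕ∞)) (by simp))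
  have hθd : ∀ n x, extDeriv (θ n) x = 0 := fun n x =>
    extDeriv_extDeriv_apply (hsm n).contDiffAt (by simpa using two_le_infty)
  have hθb : ∀ n x, ‖θ n x‖ ≤ ∑ i, 4 * ‖wedgeCoord i s‖ := fun n x =>
    norm_extDeriv_smul_coordForm_le (hw n).differentiable s ⟨0, hk⟩ (hwb n) x
  refine ⟨fun x => ∑' n, θ n x,
    memLp_tsum_of_disjoint hdisj hθz (fun n => (hθs n).continuous) hθb,
    distributionallyClosed_tsum hK hdisj hθz hθs hθd hθb, fun x hx => ?_, ?_⟩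
  · have : ∀ n, θ n x = 0 := fun n => hθz n x fun hxK => hx (hVQ (hKV n hxK))
    simp [this]
  · rintro ⟨ω, ⟨C, hC⟩, hω⟩
    have hQm : MeasurableSet (unitCube d) := by
      have : unitCube d = ⋂ i, {x | x i ∈ Set.Icc (0 : ℝ) 1} := by ext; simp [unitCube]
      rw [this]
      exact MeasurableSet.iInter fun i => measurableSet_Icc.preimage
        (stdCoord i).continuous.measurable
    rw [ae_restrict_iff' hQm] at hω
    set b : Fin (k + 1) → EuclideanSpace ℝ (Fin d) := fun j => stdVec (t j) with hb
    set R : ℝ := volume.real V with hR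
    have hKR : ∀ n, volume.real (K n) ≤ R := fun n =>
      measureReal_mono (hKV n) measure_ball_lt_top.ne
    -- The duality bound is uniform in `n` because all `K n` lie in `V`, but the pairing on `K n` is
    -- at least `n`.
    obtain ⟨n, hn⟩ := exists_nat_gt (((k : ℝ) + 1) * (C * (1 + 3 * R)))
    have hle := abs_integral_extDerivWithin_mul_le hVo hVQ (hK n) (hKV n) hC b
      (fun j => by simp [hb]) 0 j₁ (h := fun x => (∑' n, θ n x) b)
      (hω.mono fun x hx hxQ => by rw [hx hxQ]) (hg n) (L := 1 + 3 * R)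
      ((h11 n).trans (by linarith [hKR n]))
      (fun j hj => (h0 n _ (htinj.ne hj)).trans (by linarith [hKR n]))
    have heq : ∫ x, (∑' n, θ n x) b * dirDeriv (b 0) (dirDeriv (b j₁) (g n)) x =
        ∫ x, dirDeriv (stdVec (t 0)) (w n) x * dirDeriv (b 0) (dirDeriv (b j₁) (g n)) x := by
      congr 1
      funext x
      by_cases hx : x ∈ K n
      · rw [(hasSum_of_mem_of_disjoint hdisj hθz hx).tsum_eq]
        congr 1
        exact extDeriv_smul_coordForm_apply (hw n).differentiable hk t htinj x
      · rw [(((hg n).along (hK n).isClosed _).along (hK n).isClosed _).eq_zero x hx, mul_zero,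
          mul_zero]
    rw [heq] at hle
    linarith [(hpair n).trans ((le_abs_self _).trans hle)]
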